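/- Let $\mathsf{k}$ be a field, $R$ a unital (associative, not necessarily commutative) $\mathsf{k}$-algebra, and $E=(E^0,E^1,s,r)$ a finite directed graph (both the vertex set $E^0$ and the edge set $E^1$ are finite; $s,r:E^1\to E^0$ are the source and range maps). The Cohn path algebra $C_R(E)$ is the (not necessarily unital) $R$-algebra generated by the sets $E^0$, $E^1$ and $\{e^*\mid e\in E^1\}$, with coefficients commuting with the generators, subject to the following relations for all $v,w\in E^0$ and $e,f\in E^1$: (1) $vw=\delta_{v,w}w$; (2) $s(e)e=e=e\,r(e)$ and $r(e)e^*=e^*=e^*s(e)$; (3) $e^*f=\delta_{e,f}\,r(e)$. The Leavitt algebra $L_R(1,2)$ is the unital $R$-algebra generated by $x_1,x_2,x_1^*,x_2^*$, with coefficients commuting with the generators, subject to the relations $x_1x_1^*+x_2x_2^*=1$, $x_1^*x_1=x_2^*x_2=1$ and $x_1^*x_2=x_2^*x_1=0$. Then $C_R(E)$ embeds into $L_R(1,2)$: there is an injective ring homomorphism $\varphi:C_R(E)\to L_R(1,2)$ which is linear over $R$ on the left and on the right (hence in particular a homomorphism of $\mathsf{k}$-algebras), and which, if $E^0\neq\emptyset$,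 is unital, that is, $\varphi\bigl(\sum_{v\in E^0}v\bigr)=1$. -/

import Mathlib

universe s t u w

/-! Directed graphs `E = (E⁰, E¹, s, r)` are Mathlib's quivers: `E⁰` is the type `V`, the set `E¹` of
all edges is `Quiver.Total V`, and `s(e) = e.left`, `r(e) = e.right`. -/

/-! ## Cohn path algebras -/

/-- The generators of the Cohn path algebra: the vertices `v`, the edges `e`, and the ghost
edges `e*`. -/
inductive CohnGen (V : Type u) [Quiver.{w} V] : Type (max u w)
  | vertex (v : V) : CohnGen V
  | edge (e : Quiver.Total V) : CohnGen V
  | ghost (e : Quiver.Total V) : CohnGen V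

/-- The free non-unital `R`-algebra on the generators (noncommutative polynomials without constant
term). The coefficients from `R`, which need not be commutative, commute with the generators. -/
abbrev CohnFree (R : Type t) [Ring R] (V : Type u) [Quiver.{w} V] : Type (max u w t) :=
  MonoidAlgebra R (FreeSemigroup (CohnGen V))

/-- A generator, as an element of the free algebra. -/
noncomputable def CohnFree.gen (R : Type t) [Ring R] {V : Type u} [Quiver.{w} V]
    (x : CohnGen V) : CohnFree R V :=
  MonoidAlgebra.single (FreeSemigroup.of x) 1

open CohnGen CohnFree in
/-- The defining relations of the Cohn path algebra:
(1) `v w = δ_{v,w} w`; (2) `s(e) e = e = e r(e)` and `r(e) e* = e* = e* s(e)`;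
(3) `e* f = δ_{e,f} r(e)`. -/
inductive CohnRel (R : Type t) [Ring R] (V : Type u) [Quiver.{w} V] :
    CohnFree R V → CohnFree R V → Prop
  | vertex_mul_self (v : V) : CohnRel R V (gen R (vertex v) * gen R (vertex v)) (gen R (vertex v))
  | vertex_mul_vertex (v w : V) (h : v ≠ w) :
      CohnRel R V (gen R (vertex v) * gen R (vertex w)) 0
  | source_mul_edge (e : Quiver.Total V) :
      CohnRel R V (gen R (vertex e.left) * gen R (edge e)) (gen R (edge e))
  | edge_mul_range (e : Quiver.Total V) :
      CohnRel R V (gen R (edge e) * gen R (vertex e.right)) (gen R (edge e))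
  | range_mul_ghost (e : Quiver.Total V) :
      CohnRel R V (gen R (vertex e.right) * gen R (ghost e)) (gen R (ghost e))
  | ghost_mul_source (e : Quiver.Total V) :
      CohnRel R V (gen R (ghost e) * gen R (vertex e.left)) (gen R (ghost e))
  | ghost_mul_edge_self (e : Quiver.Total V) :
      CohnRel R V (gen R (ghost e) * gen R (edge e)) (gen R (vertex e.right))
  | ghost_mul_edge (e f : Quiver.Total V) (h : e ≠ f) :
      CohnRel R V (gen R (ghost e) * gen R (edge f)) 0

/-- The scalar multiples of the defining relations. As the free algebra has no unit, these multiples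
are needed for the generated ring congruence to be compatible with scalars. -/
def CohnScalarRel (R : Type t) [Ring R] (V : Type u) [Quiver.{w} V]
    (a b : CohnFree R V) : Prop :=
  ∃ (c : R) (x y : CohnFree R V), CohnRel R V x y ∧ a = c • x ∧ b = c • y

/-- The congruence on the free algebra that the defining relations generate. -/
noncomputable def cohnCon (R : Type t) [Ring R] (V : Type u) [Quiver.{w} V] : RingCon (CohnFree R V) :=
  ringConGen (CohnScalarRel R V)

/-- The Cohn path algebra `C_R(E)`. -/
def CohnPathAlgebra (R : Type t) [Ring R] (V : Type u) [Quiver.{w} V] :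
    Type (max u w t) :=
  (cohnCon R V).Quotient

namespace CohnPathAlgebra

noncomputable instance instNonUnitalRing (R : Type t) [Ring R] (V : Type u)
    [Quiver.{w} V] : NonUnitalRing (CohnPathAlgebra R V) :=
  inferInstanceAs (NonUnitalRing (cohnCon R V).Quotient)

/-- The quotient map from the free algebra. -/
noncomputable def mk (R : Type t) [Ring R] (V : Type u) [Quiver.{w} V] :
    CohnFree R V →ₙ+* CohnPathAlgebra R V where
  toFun a := (cohnCon R V).toQuotient a
  map_mul' _ _ := rfl
  map_zero' := rfl
  map_add' _ _ := rfl

theorem mk_surjective (R : Type t) [Ring R] (V : Type u) [Quiver.{w} V] :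
    Function.Surjective (mk R V) :=
  Quotient.mk_surjective

theorem con_smul (R : Type t) [Ring R] (V : Type u) [Quiver.{w} V] (c : R)
    {a b : CohnFree R V} (h : RingConGen.Rel (CohnScalarRel R V) a b) :
    RingConGen.Rel (CohnScalarRel R V) (c • a) (c • b) := by
  induction h with
  | of x y h =>
    obtain ⟨d, x, y, h, rfl, rfl⟩ := h
    exact .of _ _ ⟨c * d, x, y, h, by rw [mul_smul], by rw [mul_smul]⟩
  | refl x => exact .refl _
  | symm _ ih => exact .symm ih
  | trans _ _ ih₁ ih₂ => exact .trans ih₁ ih₂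
  | add _ _ ih₁ ih₂ => rw [smul_add, smul_add]; exact .add ih₁ ih₂
  | mul _ h₂ ih₁ _ => rw [← smul_mul_assoc, ← smul_mul_assoc]; exact .mul ih₁ h₂

theorem op_smul_of_rel (R : Type t) [Ring R] (V : Type u) [Quiver.{w} V] (c d : R)
    {x y : CohnFree R V} (h : CohnRel R V x y) :
    MulOpposite.op c • d • x = (d * c) • x ∧ MulOpposite.op c • d • y = (d * c) • y := by
  cases h <;> simp [CohnFree.gen, MonoidAlgebra.single_mul_single]

theorem con_op_smul (R : Type t) [Ring R] (V : Type u) [Quiver.{w} V] (c : R)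
    {a b : CohnFree R V} (h : RingConGen.Rel (CohnScalarRel R V) a b) :
    RingConGen.Rel (CohnScalarRel R V) (MulOpposite.op c • a) (MulOpposite.op c • b) := by
  induction h with
  | of x y h =>
    obtain ⟨d, x, y, h, rfl, rfl⟩ := h
    exact .of _ _ ⟨d * c, x, y, h, (op_smul_of_rel R V c d h).1, (op_smul_of_rel R V c d h).2⟩
  | refl x => exact .refl _
  | symm _ ih => exact .symm ih
  | trans _ _ ih₁ ih₂ => exact .trans ih₁ ih₂
  | add _ _ ih₁ ih₂ => rw [smul_add, smul_add]; exact .add ih₁ ih₂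
  | mul h₁ _ _ ih₂ => rw [← mul_smul_comm, ← mul_smul_comm]; exact .mul h₁ ih₂

/-- Left multiplication by scalars. -/
noncomputable instance instSMul (R : Type t) [Ring R] (V : Type u) [Quiver.{w} V] :
    SMul R (CohnPathAlgebra R V) where
  smul c := Quotient.map (c • ·) fun _ _ h => con_smul R V c h

/-- Right multiplication by scalars. -/
noncomputable instance instSMulOp (R : Type t) [Ring R] (V : Type u) [Quiver.{w} V] :
    SMul Rᵐᵒᵖ (CohnPathAlgebra R V) where
  smul c := Quotient.map (c • ·) fun _ _ h => con_op_smul R V c.unop h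

noncomputable instance instModule (R : Type t) [Ring R] (V : Type u) [Quiver.{w} V] :
    Module R (CohnPathAlgebra R V) :=
  Function.Surjective.module R (mk R V : CohnFree R V →+ CohnPathAlgebra R V)
    (mk_surjective R V) fun _ _ => rfl

noncomputable instance instModuleOp (R : Type t) [Ring R] (V : Type u) [Quiver.{w} V] :
    Module Rᵐᵒᵖ (CohnPathAlgebra R V) :=
  Function.Surjective.module Rᵐᵒᵖ (mk R V : CohnFree R V →+ CohnPathAlgebra R V)
    (mk_surjective R V) fun _ _ => rfl

/-- The vertex `v` as an element of the Cohn path algebra. -/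
noncomputable def vertex (R : Type t) [Ring R] {V : Type u} [Quiver.{w} V] (v : V) :
    CohnPathAlgebra R V :=
  mk R V (CohnFree.gen R (.vertex v))

end CohnPathAlgebra

/-! ## The Leavitt algebra `L_R(1,2)` -/

/-- The generators `x i` and `xStar i` (that is, `x_i*`) of `L_R(1,2)`. -/
inductive LeavittGen : Type
  | x (i : Fin 2) : LeavittGen
  | xStar (i : Fin 2) : LeavittGen

/-- The free unital `R`-algebra on the generators; the coefficients commute with the generators. -/
abbrev LeavittFree (R : Type t) [Ring R] : Type t := MonoidAlgebra R (FreeMonoid LeavittGen)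

/-- A generator, as an element of the free algebra. -/
noncomputable def LeavittFree.gen (R : Type t) [Ring R] (a : LeavittGen) : LeavittFree R :=
  MonoidAlgebra.single (FreeMonoid.of a) 1

open LeavittGen LeavittFree in
/-- The defining relations of `L_R(1,2)`:
`x₁ x₁* + x₂ x₂* = 1`, `x₁* x₁ = x₂* x₂ = 1`, `x₁* x₂ = x₂* x₁ = 0`. -/
inductive LeavittRel (R : Type t) [Ring R] : LeavittFree R → LeavittFree R → Prop
  | sum_eq_one :
      LeavittRel R (gen R (x 0) * gen R (xStar 0) + gen R (x 1) * gen R (xStar 1)) 1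
  | star_mul_self (i : Fin 2) : LeavittRel R (gen R (xStar i) * gen R (x i)) 1
  | star_mul (i j : Fin 2) (h : i ≠ j) : LeavittRel R (gen R (xStar i) * gen R (x j)) 0

/-- The Leavitt algebra `L_R(1,2)`. -/
def LeavittAlgebra (R : Type t) [Ring R] : Type t := (ringConGen (LeavittRel R)).Quotient

namespace LeavittAlgebra

noncomputable instance instRing (R : Type t) [Ring R] : Ring (LeavittAlgebra R) :=
  inferInstanceAs (Ring (ringConGen (LeavittRel R)).Quotient)

/-- The quotient map from the free algebra. -/
noncomputable def mk (R : Type t) [Ring R] : LeavittFree R →+* LeavittAlgebra R :=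
  (ringConGen (LeavittRel R)).mk'

/-- The structure map `R → L_R(1,2)`; left and right multiplication by the image of `c` is left and
right multiplication by the scalar `c`. -/
noncomputable def coeff (R : Type t) [Ring R] : R →+* LeavittAlgebra R :=
  (mk R).comp MonoidAlgebra.singleOneRingHom

end LeavittAlgebra

/-! ## The representation of the Leavitt algebra on sequences -/

/-! Choose monomials W_v (v a vertex) and U_e (e an edge) in x₁, x₂ with W_v* W_w = δ and U_e* U_f =
δ. Then v ↦ W_v W_v*, e ↦ W_{s(e)} U_e W_{r(e)}*, e* ↦ W_{r(e)} U_e* W_{s(e)}* respects the Cohn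
relations. If the W_v W_v* sum to 1, the map is unital (`exists_code_sum_eq_one`).

For injectivity, the elements α β* span C_R(E) (`exists_eq_sum_normalForm`), and α β* is sent to
(W_a U_α)(W_b U_β)*, with a and b the starts of α and β (`IsPathPair.hom_normalForm`). Let L_R(1,2)
act on sequences ℕ → R, with x₁ and x₂ pushing forward along n ↦ 2n and n ↦ 2n + 1. A path α then
gives an injection σ_α of ℕ, and α β* acts by the matrix with entry 1 at the points (σ_α(k), σ_β(k))
and 0 elsewhere (`Implements.rep_mul_single`).

The U_e are chosen so that none of their maps takes the value 0 (`exists_code_shift_ne_zero`). Then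
σ_α(0) determines α, and a path β' not shorter than β has σ_β(0) in the range of σ_{β'} only if β' =
β (`pathShift_zero_eq`). In a nonzero combination take a term c α β* with β of minimal length: the
entry at (σ_α(0), σ_β(0)) is c alone, so the image is not 0 (`hom_injective`). Neither faithfulness
of the action nor prior independence of the α β* is needed. -/

namespace LeavittAlgebra

variable (R : Type t) [Ring R]

/-- The operator on sequences by which a generator of `L_R(1,2)` acts. -/
def genOp : LeavittGen → AddMonoid.End (ℕ → R)
  | .x i =>
    { toFun := fun f m => if m % 2 = i then f (m / 2) else 0
      map_zero' := by ext; simp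
      map_add' := fun f g => by ext m; dsimp; split_ifs <;> simp }
  | .xStar i =>
    { toFun := fun f n => f (2 * n + i)
      map_zero' := rfl
      map_add' := fun _ _ => rfl }

theorem genOp_x (i : Fin 2) (f : ℕ → R) (m : ℕ) :
    genOp R (.x i) f m = if m % 2 = i then f (m / 2) else 0 := rfl

theorem genOp_xStar (i : Fin 2) (f : ℕ → R) (n : ℕ) :
    genOp R (.xStar i) f n = f (2 * n + i) := rfl

theorem end_mul_apply {M : Type*} [AddCommMonoid M] (S T : AddMonoid.End M) (x : M) :
    (S * T) x = S (T x) := rfl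

theorem toAddMonoidEnd_apply (c : R) (f : ℕ → R) :
    Module.toAddMonoidEnd R (ℕ → R) c f = c • f := rfl

/-- The generators only move entries or put in zeros, so they commute with entrywise multiplication.
The action is by additive maps because left multiplication by `c` need not be left `R`-linear. -/
theorem commute_toAddMonoidEnd_genOp (c : R) (a : LeavittGen) :
    Commute (Module.toAddMonoidEnd R (ℕ → R) c) (genOp R a) := by
  cases a <;> ext f n <;>
    simp [genOp_x, genOp_xStar, end_mul_apply, toAddMonoidEnd_apply]

/-- The action of the free algebra on sequences. -/
noncomputable def freeRep : LeavittFree R →+* AddMonoid.End (ℕ → R) :=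
  MonoidAlgebra.liftNCRingHom (Module.toAddMonoidEnd R (ℕ → R)) (FreeMonoid.lift (genOp R))
    fun c w => by
      induction w using FreeMonoid.inductionOn with
      | one => simp
      | of a => simpa using commute_toAddMonoidEnd_genOp R c a
      | mul v w hv hw => simpa using hv.mul_right hw

theorem freeRep_gen (a : LeavittGen) : freeRep R (LeavittFree.gen R a) = genOp R a := by
  simp [freeRep, LeavittFree.gen]

/-- The relations express that every natural number is 2n or 2n + 1 for exactly one n, and never
both. -/
theorem freeRep_eq_of_rel {a b : LeavittFree R} (h : LeavittRel R a b) :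
    freeRep R a = freeRep R b := by
  cases h with
  | sum_eq_one =>
    simp only [map_add, map_mul, freeRep_gen, map_one]
    ext f n
    change genOp R (.x 0) (genOp R (.xStar 0) f) n + genOp R (.x 1) (genOp R (.xStar 1) f) n = f n
    simp only [genOp_x, genOp_xStar]
    rcases Nat.mod_two_eq_zero_or_one n with h | h
    · simp [h, show 2 * (n / 2) = n by omega]
    · simp [h, show 2 * (n / 2) + 1 = n by omega]
  | star_mul_self i =>
    simp only [map_mul, freeRep_gen, map_one]
    ext f n
    have h : (2 * n + i.val) % 2 = i := by omega
    have h' : (2 * n + i.val) / 2 = n := by omega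
    simp [genOp_x, genOp_xStar, end_mul_apply, h, h']
  | star_mul i j hij =>
    simp only [map_mul, freeRep_gen, map_zero]
    ext f n
    have h : ¬ (2 * n + i.val) % 2 = j := by omega
    rw [end_mul_apply, genOp_xStar, genOp_x, if_neg h]
    rfl

/-- The action of `L_R(1,2)` on sequences. -/
noncomputable def rep : LeavittAlgebra R →+* AddMonoid.End (ℕ → R) :=
  RingCon.lift (ringConGen (LeavittRel R)) (freeRep R)
    (RingCon.ringConGen_le.2 fun _ _ h => freeRep_eq_of_rel R h)

theorem rep_mk (a : LeavittFree R) : rep R (mk R a) = freeRep R a := rfl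

theorem rep_coeff (c : R) (f : ℕ → R) : rep R (coeff R c) f = c • f := by
  simp [coeff, rep_mk, freeRep, toAddMonoidEnd_apply]

/-- A generator of `L_R(1,2)`. -/
noncomputable def gen (a : LeavittGen) : LeavittAlgebra R := mk R (LeavittFree.gen R a)

theorem rep_gen (a : LeavittGen) : rep R (gen R a) = genOp R a := by
  rw [gen, rep_mk, freeRep_gen]

theorem mk_eq_of_rel {a b : LeavittFree R} (h : LeavittRel R a b) : mk R a = mk R b :=
  Quotient.sound (RingConGen.Rel.of _ _ h)

theorem sum_gen_mul_gen :
    gen R (.x 0) * gen R (.xStar 0) + gen R (.x 1) * gen R (.xStar 1) = 1 := by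
  simpa [gen] using mk_eq_of_rel R .sum_eq_one

theorem gen_xStar_mul_gen_x (i j : Fin 2) :
    gen R (.xStar i) * gen R (.x j) = if i = j then 1 else 0 := by
  split_ifs with h
  · subst h; simpa [gen] using mk_eq_of_rel R (.star_mul_self i)
  · simpa [gen] using mk_eq_of_rel R (.star_mul i j h)

theorem commute_coeff_gen (c : R) (a : LeavittGen) : Commute (coeff R c) (gen R a) := by
  simp only [Commute, SemiconjBy, coeff, gen, RingHom.comp_apply, ← map_mul]
  congr 1
  simp [LeavittFree.gen, MonoidAlgebra.single_mul_single]

/-! ### Isometries of the Leavitt algebra acting by injections of ℕ -/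

variable {R}

/-- The elements `a` and `b` of `L_R(1,2)` commute with the scalars, `a` acts on sequences by
pushing forward along `σ`, and `b` acts by pulling back along `σ`. -/
structure Implements (a b : LeavittAlgebra R) (σ : ℕ → ℕ) : Prop where
  commute_left (c : R) : Commute (coeff R c) a
  commute_right (c : R) : Commute (coeff R c) b
  push (f : ℕ → R) (n : ℕ) : rep R a f (σ n) = f n
  push_eq_zero (f : ℕ → R) (m : ℕ) (h : m ∉ Set.range σ) : rep R a f m = 0
  pull (f : ℕ → R) (n : ℕ) : rep R b f n = f (σ n)

theorem Implements.one : Implements (1 : LeavittAlgebra R) 1 id where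
  commute_left _ := .one_right _
  commute_right _ := .one_right _
  push f n := by simp
  push_eq_zero f m h := by simp at h
  pull f n := by simp

theorem Implements.mul {a b a' b' : LeavittAlgebra R} {σ τ : ℕ → ℕ} (h : Implements a b σ)
    (h' : Implements a' b' τ) : Implements (a * a') (b' * b) (σ ∘ τ) where
  commute_left c := (h.commute_left c).mul_right (h'.commute_left c)
  commute_right c := (h'.commute_right c).mul_right (h.commute_right c)
  push f n := by simp [end_mul_apply, h.push, h'.push]
  push_eq_zero f m hm := by
    rw [map_mul, end_mul_apply]
    by_cases hσ : m ∈ Set.range σ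
    · obtain ⟨k, rfl⟩ := hσ
      rw [h.push]
      refine h'.push_eq_zero _ _ ?_
      rintro ⟨n, rfl⟩
      exact hm ⟨n, rfl⟩
    · exact h.push_eq_zero _ _ hσ
  pull f n := by simp [end_mul_apply, h.pull, h'.pull]

theorem implements_gen (i : Fin 2) :
    Implements (gen R (.x i)) (gen R (.xStar i)) fun n => 2 * n + i where
  commute_left c := commute_coeff_gen R c _
  commute_right c := commute_coeff_gen R c _
  push f n := by
    have h : (2 * n + i.val) % 2 = i := by omega
    have h' : (2 * n + i.val) / 2 = n := by omega
    simp [rep_gen, genOp_x, h, h']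
  push_eq_zero f m hm := by
    have h : ¬ m % 2 = i := fun h => hm ⟨m / 2, by dsimp; omega⟩
    simp [rep_gen, genOp_x, h]
  pull f n := by simp [rep_gen, genOp_xStar]

/-- The matrix entry of `c a b'` at `(m, n)`. -/
theorem Implements.rep_mul_single {a b a' b' : LeavittAlgebra R} {σ τ : ℕ → ℕ}
    (h : Implements a b σ) (h' : Implements a' b' τ) (c : R) (m n : ℕ)
    [Decidable (∃ k, σ k = m ∧ τ k = n)]
    (hσ : Function.Injective σ) :
    rep R (coeff R c * (a * b')) (Pi.single n 1) m = if ∃ k, σ k = m ∧ τ k = n then c else 0 := by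
  rw [map_mul, map_mul, end_mul_apply, end_mul_apply, rep_coeff, Pi.smul_apply]
  by_cases hm : m ∈ Set.range σ
  · obtain ⟨k, rfl⟩ := hm
    rw [h.push, h'.pull, Pi.single_apply]
    -- Injectivity of σ leaves `k` as the only possible witness.
    simp only [hσ.eq_iff, exists_eq_left]
    split_ifs <;> simp
  · rw [h.push_eq_zero _ _ hm, if_neg fun ⟨k, hk, _⟩ => hm ⟨k, hk⟩, smul_zero]

/-- A finite family of isometries with orthogonal ranges in `L_R(1,2)`, given by words in the
generators, together with the maps on `ℕ` by which it acts. -/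
structure Code (R : Type t) [Ring R] (ι : Type*) where
  word : ι → LeavittAlgebra R
  star : ι → LeavittAlgebra R
  shift : ι → ℕ → ℕ
  implements (i : ι) : Implements (word i) (star i) (shift i)
  star_mul_self (i : ι) : star i * word i = 1
  star_mul_of_ne {i j : ι} (h : i ≠ j) : star i * word j = 0
  shift_injective : Function.Injective fun p : ι × ℕ => shift p.1 p.2

/-- Restriction of a family of isometries along an injective map. -/
def Code.comap {ι κ : Type*} (C : Code R ι) (f : κ ↪ ι) : Code R κ where
  word i := C.word (f i)
  star i := C.star (f i)
  shift i := C.shift (f i)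
  implements i := C.implements (f i)
  star_mul_self i := C.star_mul_self (f i)
  star_mul_of_ne h := C.star_mul_of_ne (f.injective.ne h)
  shift_injective p q h := by
    have := @C.shift_injective (f p.1, p.2) (f q.1, q.2) h
    simpa [Prod.ext_iff] using this

/-- The words are x₂, x₁x₂, x₁²x₂, …, ending with x₁ⁿ: the old code is prefixed by x₁ and the word
x₂ is added. The last word acts by k ↦ 2ⁿk and so fixes 0. -/
theorem exists_code (R : Type t) [Ring R] (n : ℕ) :
    ∃ C : Code R (Fin (n + 1)),
      ∑ i, C.word i * C.star i = 1 ∧ C.shift (Fin.last n) 0 = 0 := by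
  induction n with
  | zero =>
    refine ⟨⟨1, 1, fun _ => id, fun _ => .one, fun _ => one_mul 1, fun {i j} h => ?_,
      fun p q h => Prod.ext (Subsingleton.elim (α := Fin 1) _ _) h⟩, by simp, rfl⟩
    exact absurd (Subsingleton.elim (α := Fin 1) _ _) h
  | succ n ih =>
    obtain ⟨C, hsum, hlast⟩ := ih
    refine ⟨⟨Fin.cons (gen R (.x 1)) fun i => gen R (.x 0) * C.word i,
      Fin.cons (gen R (.xStar 1)) fun i => C.star i * gen R (.xStar 0),
      Fin.cons (fun n => 2 * n + (1 : Fin 2).val)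
        fun i => (fun n => 2 * n + (0 : Fin 2).val) ∘ C.shift i, ?_, ?_, ?_, ?_⟩, ?_, ?_⟩
    · refine Fin.cases ?_ fun i => ?_
      · exact implements_gen 1
      · exact (implements_gen 0).mul (C.implements i)
    · refine Fin.cases ?_ fun i => ?_
      · simp [gen_xStar_mul_gen_x]
      · simp only [Fin.cons_succ]
        rw [mul_assoc, ← mul_assoc (gen R _), gen_xStar_mul_gen_x, if_pos rfl, one_mul,
          C.star_mul_self]
    · intro i j
      refine Fin.cases ?_ (fun i => ?_) i <;> refine Fin.cases ?_ (fun j => ?_) j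
      · simp
      · intro _
        simp [← mul_assoc, gen_xStar_mul_gen_x]
      · intro _
        simp [mul_assoc, gen_xStar_mul_gen_x]
      · intro h
        simp only [Fin.cons_succ]
        rw [mul_assoc, ← mul_assoc (gen R _), gen_xStar_mul_gen_x, if_pos rfl, one_mul,
          C.star_mul_of_ne (by simpa using h)]
    · rintro ⟨i, m⟩ ⟨j, n⟩
      refine Fin.cases ?_ (fun i => ?_) i <;> refine Fin.cases ?_ (fun j => ?_) j
      · simp
      · simp; omega
      · simp; omega
      · intro h
        have h' : C.shift i m = C.shift j n := by simpa using h
        have := @C.shift_injective (i, m) (j, n) h'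
        simpa [Prod.ext_iff] using this
    · rw [Fin.sum_univ_succ]
      simp only [Fin.cons_zero, Fin.cons_succ]
      have : ∀ i, gen R (.x 0) * C.word i * (C.star i * gen R (.xStar 0)) =
          gen R (.x 0) * (C.word i * C.star i) * gen R (.xStar 0) := fun i => by
        simp only [mul_assoc]
      simp only [this]
      rw [← Finset.sum_mul, ← Finset.mul_sum, hsum, mul_one, add_comm, sum_gen_mul_gen]
    · rw [← Fin.succ_last]
      simp [hlast]

end LeavittAlgebra

/-! ## Normal forms in the Cohn path algebra -/

namespace CohnPathAlgebra

variable (R : Type t) [Ring R] {V : Type u} [Quiver.{w} V]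

/-- An edge as an element of the Cohn path algebra. -/
noncomputable def edge (e : Quiver.Total V) : CohnPathAlgebra R V :=
  mk R V (CohnFree.gen R (.edge e))

/-- A ghost edge as an element of the Cohn path algebra. -/
noncomputable def ghost (e : Quiver.Total V) : CohnPathAlgebra R V :=
  mk R V (CohnFree.gen R (.ghost e))

theorem mk_eq_of_rel {a b : CohnFree R V} (h : CohnRel R V a b) : mk R V a = mk R V b :=
  Quotient.sound (RingConGen.Rel.of _ _ ⟨1, a, b, h, by simp, by simp⟩)

theorem vertex_mul_self (v : V) : vertex R v * vertex R v = vertex R v := by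
  simpa [vertex, edge, ghost] using mk_eq_of_rel R (.vertex_mul_self v)

theorem vertex_mul_vertex {v w : V} (h : v ≠ w) : vertex R v * vertex R w = 0 := by
  simpa [vertex, edge, ghost] using mk_eq_of_rel R (.vertex_mul_vertex v w h)

theorem source_mul_edge (e : Quiver.Total V) : vertex R e.left * edge R e = edge R e := by
  simpa [vertex, edge, ghost] using mk_eq_of_rel R (.source_mul_edge e)

theorem edge_mul_range (e : Quiver.Total V) : edge R e * vertex R e.right = edge R e := by
  simpa [vertex, edge, ghost] using mk_eq_of_rel R (.edge_mul_range e)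

theorem range_mul_ghost (e : Quiver.Total V) : vertex R e.right * ghost R e = ghost R e := by
  simpa [vertex, edge, ghost] using mk_eq_of_rel R (.range_mul_ghost e)

theorem ghost_mul_source (e : Quiver.Total V) : ghost R e * vertex R e.left = ghost R e := by
  simpa [vertex, edge, ghost] using mk_eq_of_rel R (.ghost_mul_source e)

theorem ghost_mul_edge_self (e : Quiver.Total V) : ghost R e * edge R e = vertex R e.right := by
  simpa [vertex, edge, ghost] using mk_eq_of_rel R (.ghost_mul_edge_self e)

theorem ghost_mul_edge {e f : Quiver.Total V} (h : e ≠ f) : ghost R e * edge R f = 0 := by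
  simpa [vertex, edge, ghost] using mk_eq_of_rel R (.ghost_mul_edge e f h)

/-- The lists of edges `α` and `β` are paths that start at `a` and at `b` and have the same end. -/
inductive IsPathPair : V → List (Quiver.Total V) → V → List (Quiver.Total V) → Prop
  | nil (v : V) : IsPathPair v [] v []
  | ghost (e : Quiver.Total V) {b : V} {β : List (Quiver.Total V)} (h : IsPathPair e.left [] b β) :
      IsPathPair e.right [] b (β ++ [e])
  | edge (e : Quiver.Total V) {b : V} {α β : List (Quiver.Total V)}
      (h : IsPathPair e.right α b β) : IsPathPair e.left (e :: α) b β

/-- The element `α β*`, where the path `β` starts at `b`. -/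
noncomputable def normalForm (α : List (Quiver.Total V)) (b : V) (β : List (Quiver.Total V)) :
    CohnPathAlgebra R V :=
  α.foldr (edge R · * ·) (β.foldl (fun x e => ghost R e * x) (vertex R b))

theorem normalForm_cons (e : Quiver.Total V) (α : List (Quiver.Total V)) (b : V)
    (β : List (Quiver.Total V)) :
    normalForm R (e :: α) b β = edge R e * normalForm R α b β := rfl

theorem normalForm_append_singleton (e : Quiver.Total V) (b : V) (β : List (Quiver.Total V)) :
    normalForm R [] b (β ++ [e]) = ghost R e * normalForm R [] b β := by
  simp [normalForm]

variable {R}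

theorem IsPathPair.vertex_mul {a b : V} {α β : List (Quiver.Total V)} (h : IsPathPair a α b β) :
    vertex R a * normalForm R α b β = normalForm R α b β := by
  cases h with
  | nil => exact vertex_mul_self R _
  | ghost e h => rw [normalForm_append_singleton, ← mul_assoc, range_mul_ghost]
  | edge e h => rw [normalForm_cons, ← mul_assoc, source_mul_edge]

theorem IsPathPair.vertex_mul_of_ne {a b v : V} {α β : List (Quiver.Total V)}
    (h : IsPathPair a α b β) (hv : v ≠ a) : vertex R v * normalForm R α b β = 0 := by
  rw [← h.vertex_mul, ← mul_assoc, vertex_mul_vertex R hv, zero_mul]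

variable (R V) in
/-- The elements `α β*` for paths `α` and `β` with the same end. -/
def normalForms : Set (CohnPathAlgebra R V) :=
  {x | ∃ a α b β, IsPathPair a α b β ∧ normalForm R α b β = x}

theorem vertex_mul_normalForm_mem (v : V) {x : CohnPathAlgebra R V} (hx : x ∈ normalForms R V) :
    vertex R v * x = 0 ∨ vertex R v * x ∈ normalForms R V := by
  obtain ⟨a, α, b, β, h, rfl⟩ := hx
  by_cases hv : v = a
  · subst hv
    exact .inr ⟨_, _, _, _, h, h.vertex_mul.symm⟩
  · exact .inl (h.vertex_mul_of_ne hv)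

theorem edge_mul_normalForm_mem (e : Quiver.Total V) {x : CohnPathAlgebra R V}
    (hx : x ∈ normalForms R V) : edge R e * x = 0 ∨ edge R e * x ∈ normalForms R V := by
  obtain ⟨a, α, b, β, h, rfl⟩ := hx
  by_cases hv : e.right = a
  · subst hv
    exact .inr ⟨_, _, _, _, .edge e h, rfl⟩
  · rw [← edge_mul_range, mul_assoc, h.vertex_mul_of_ne hv, mul_zero]
    exact .inl rfl

/-- Relation (3) is used here: e* cancels the first edge of α or kills the product. If α is empty,
e* instead lengthens β at its end. -/
theorem ghost_mul_normalForm_mem (e : Quiver.Total V) {x : CohnPathAlgebra R V}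
    (hx : x ∈ normalForms R V) : ghost R e * x = 0 ∨ ghost R e * x ∈ normalForms R V := by
  obtain ⟨a, α, b, β, h, rfl⟩ := hx
  cases α with
  | nil =>
    by_cases hv : e.left = a
    · subst hv
      exact .inr ⟨_, _, _, _, .ghost e h, normalForm_append_singleton R e b β⟩
    · rw [← ghost_mul_source, mul_assoc, h.vertex_mul_of_ne hv, mul_zero]
      exact .inl rfl
  | cons f α =>
    cases h with
    | edge _ h =>
      rw [normalForm_cons, ← mul_assoc]
      by_cases hf : e = f
      · subst hf
        rw [ghost_mul_edge_self, h.vertex_mul]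
        exact .inr ⟨_, _, _, _, h, rfl⟩
      · rw [ghost_mul_edge R hf, zero_mul]
        exact .inl rfl

theorem mk_gen_mul_normalForm_mem (g : CohnGen V) {x : CohnPathAlgebra R V}
    (hx : x ∈ normalForms R V) : mk R V (CohnFree.gen R g) * x = 0 ∨
      mk R V (CohnFree.gen R g) * x ∈ normalForms R V := by
  cases g with
  | vertex v => exact vertex_mul_normalForm_mem v hx
  | edge e => exact edge_mul_normalForm_mem e hx
  | ghost e => exact ghost_mul_normalForm_mem e hx

theorem mk_gen_mem (g : CohnGen V) : mk R V (CohnFree.gen R g) ∈ normalForms R V := by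
  cases g with
  | vertex v => exact ⟨_, _, _, _, .nil v, rfl⟩
  | edge e => exact ⟨_, _, _, _, .edge e (.nil _), edge_mul_range R e⟩
  | ghost e => exact ⟨_, _, _, _, .ghost e (.nil _), ghost_mul_source R e⟩

/-- The normal forms together with 0 are stable under left multiplication by generators, so a word
is reduced by peeling off its first letter. -/
theorem mk_single_mem (x : FreeSemigroup (CohnGen V)) :
    mk R V (MonoidAlgebra.single x 1) = 0 ∨
      mk R V (MonoidAlgebra.single x 1) ∈ normalForms R V := by
  induction x with
  | ih1 g => exact .inr (mk_gen_mem g)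
  | ih2 g x _ ih =>
    have : (MonoidAlgebra.single (FreeSemigroup.of g * x) 1 : CohnFree R V) =
        CohnFree.gen R g * MonoidAlgebra.single x 1 := by
      simp [CohnFree.gen, MonoidAlgebra.single_mul_single]
    rw [this, map_mul]
    rcases ih with h | h
    · simp [h]
    · exact mk_gen_mul_normalForm_mem g h

theorem mk_smul (c : R) (x : CohnFree R V) : mk R V (c • x) = c • mk R V x := rfl

variable (R V) in
theorem span_normalForms : Submodule.span R (normalForms R V) = ⊤ := by
  refine Submodule.eq_top_iff'.2 fun y => ?_
  obtain ⟨x, rfl⟩ := mk_surjective R V y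
  induction x using MonoidAlgebra.induction_linear with
  | zero => rw [map_zero]; exact zero_mem _
  | add f g hf hg => rw [map_add]; exact add_mem hf hg
  | single x c =>
    have : (MonoidAlgebra.single x c : CohnFree R V) = c • MonoidAlgebra.single x 1 := by simp
    rw [this, mk_smul]
    refine Submodule.smul_mem _ _ ?_
    rcases mk_single_mem (R := R) x with h | h
    · rw [h]; exact zero_mem _
    · exact Submodule.subset_span h

variable (V) in
/-- The pairs of paths with the same end, each given by its start and its list of edges. -/
abbrev PathPair : Type max u w :=
  {p : (V × List (Quiver.Total V)) × (V × List (Quiver.Total V)) //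
    IsPathPair p.1.1 p.1.2 p.2.1 p.2.2}

theorem exists_eq_sum_normalForm (x : CohnPathAlgebra R V) :
    ∃ c : PathPair V →₀ R,
      (c.sum fun p r => r • normalForm R p.1.1.2 p.1.2.1 p.1.2.2) = x := by
  rw [← Finsupp.mem_span_range_iff_exists_finsupp, show Set.range _ = normalForms R V from ?_,
    span_normalForms]
  · trivial
  · ext y
    constructor
    · rintro ⟨p, rfl⟩
      exact ⟨_, _, _, _, p.2, rfl⟩
    · rintro ⟨a, α, b, β, h, rfl⟩
      exact ⟨⟨((a, α), (b, β)), h⟩, rfl⟩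

/-! ## The embedding -/

open LeavittAlgebra

section Embedding

variable (W : Code R V) (U : Code R (Quiver.Total V))

/-- The image of a generator of the Cohn path algebra in `L_R(1,2)`. -/
noncomputable def genImage : CohnGen V → LeavittAlgebra R
  | .vertex v => W.word v * W.star v
  | .edge e => W.word e.left * U.word e * W.star e.right
  | .ghost e => W.word e.right * U.star e * W.star e.left

theorem commute_coeff_genImage (c : R) (g : CohnGen V) :
    Commute (coeff R c) (genImage W U g) := by
  have hw v := (W.implements v).commute_left c
  have hw' v := (W.implements v).commute_right c
  have hu e := (U.implements e).commute_left c
  have hu' e := (U.implements e).commute_right c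
  cases g with
  | vertex v => exact (hw v).mul_right (hw' v)
  | edge e => exact ((hw _).mul_right (hu e)).mul_right (hw' _)
  | ghost e => exact ((hw _).mul_right (hu' e)).mul_right (hw' _)

theorem commute_coeff_lift_genImage (c : R) (x : FreeSemigroup (CohnGen V)) :
    Commute (coeff R c) (FreeSemigroup.lift (genImage W U) x) := by
  induction x with
  | ih1 g => simpa using commute_coeff_genImage W U c g
  | ih2 g x hg hx => rw [map_mul]; exact hg.mul_right hx

/-- The homomorphism from the free algebra to `L_R(1,2)`. -/
noncomputable def freeHom : CohnFree R V →ₙ+* LeavittAlgebra R where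
  __ := MonoidAlgebra.liftNC (coeff R : R →+ LeavittAlgebra R) (FreeSemigroup.lift (genImage W U))
  map_mul' _ _ := MonoidAlgebra.liftNC_mul _ _ _ _ fun _ => commute_coeff_lift_genImage W U _ _

theorem freeHom_single (x : FreeSemigroup (CohnGen V)) (c : R) :
    freeHom W U (MonoidAlgebra.single x c) =
      coeff R c * FreeSemigroup.lift (genImage W U) x :=
  MonoidAlgebra.liftNC_single _ _ _ _

theorem freeHom_gen (g : CohnGen V) : freeHom W U (CohnFree.gen R g) = genImage W U g := by
  simp [CohnFree.gen, freeHom_single]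

theorem freeHom_smul (c : R) (x : CohnFree R V) :
    freeHom W U (c • x) = coeff R c * freeHom W U x := by
  induction x using MonoidAlgebra.induction_linear with
  | zero => simp
  | add f g hf hg => simp only [smul_add, map_add, hf, hg, mul_add]
  | single x d => simp [freeHom_single, mul_assoc]

theorem freeHom_op_smul (c : R) (x : CohnFree R V) :
    freeHom W U (MulOpposite.op c • x) = freeHom W U x * coeff R c := by
  induction x using MonoidAlgebra.induction_linear with
  | zero => simp
  | add f g hf hg => simp only [smul_add, map_add, hf, hg, add_mul]
  | single x d =>
    simp [freeHom_single, mul_assoc, (commute_coeff_lift_genImage W U c x).eq]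

theorem star_mul_word_cancel {ι : Type*} (C : Code R ι) (i : ι) (x : LeavittAlgebra R) :
    C.star i * (C.word i * x) = x := by
  rw [← mul_assoc, C.star_mul_self, one_mul]

theorem star_mul_word_mul_of_ne {ι : Type*} (C : Code R ι) {i j : ι} (h : i ≠ j)
    (x : LeavittAlgebra R) : C.star i * (C.word j * x) = 0 := by
  rw [← mul_assoc, C.star_mul_of_ne h, zero_mul]

theorem freeHom_eq_of_rel {x y : CohnFree R V} (h : CohnRel R V x y) :
    freeHom W U x = freeHom W U y := by
  cases h with
  | vertex_mul_vertex v w h =>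
    simp [freeHom_gen, genImage, mul_assoc, star_mul_word_mul_of_ne W h]
  | ghost_mul_edge e f h =>
    simp only [map_mul, map_zero, freeHom_gen, genImage, mul_assoc]
    -- With equal sources the inner factors from `W` cancel and `U` separates the edges; otherwise
    -- `W` already gives 0.
    by_cases hl : e.left = f.left
    · rw [hl, star_mul_word_cancel, star_mul_word_mul_of_ne U h, mul_zero]
    · rw [star_mul_word_mul_of_ne W hl, mul_zero, mul_zero]
  | _ => simp [freeHom_gen, genImage, mul_assoc, star_mul_word_cancel]

/-- The homomorphism from the Cohn path algebra to `L_R(1,2)` that two families of isometries,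
indexed by the vertices and by the edges, define. -/
noncomputable def hom : CohnPathAlgebra R V →ₙ+* LeavittAlgebra R where
  toFun := Quotient.lift (freeHom W U) fun x y h => by
    change RingConGen.Rel (CohnScalarRel R V) x y at h
    induction h with
    | of x y h =>
      obtain ⟨c, x, y, h, rfl, rfl⟩ := h
      rw [freeHom_smul, freeHom_smul, freeHom_eq_of_rel W U h]
    | refl => rfl
    | symm _ ih => exact ih.symm
    | trans _ _ ih₁ ih₂ => exact ih₁.trans ih₂
    | add _ _ ih₁ ih₂ => rw [map_add, map_add, ih₁, ih₂]
    | mul _ _ ih₁ ih₂ => rw [map_mul, map_mul, ih₁, ih₂]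
  map_mul' x y := by
    obtain ⟨x, rfl⟩ := mk_surjective R V x
    obtain ⟨y, rfl⟩ := mk_surjective R V y
    exact map_mul (freeHom W U) x y
  map_zero' := map_zero (freeHom W U)
  map_add' x y := by
    obtain ⟨x, rfl⟩ := mk_surjective R V x
    obtain ⟨y, rfl⟩ := mk_surjective R V y
    exact map_add (freeHom W U) x y

theorem hom_smul (c : R) (x : CohnPathAlgebra R V) : hom W U (c • x) = coeff R c * hom W U x := by
  obtain ⟨x, rfl⟩ := mk_surjective R V x
  exact freeHom_smul W U c x

theorem hom_op_smul (c : R) (x : CohnPathAlgebra R V) :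
    hom W U (MulOpposite.op c • x) = hom W U x * coeff R c := by
  obtain ⟨x, rfl⟩ := mk_surjective R V x
  exact freeHom_op_smul W U c x

theorem hom_vertex (v : V) : hom W U (vertex R v) = W.word v * W.star v := freeHom_gen W U _

theorem hom_edge (e : Quiver.Total V) :
    hom W U (edge R e) = W.word e.left * U.word e * W.star e.right := freeHom_gen W U _

theorem hom_ghost (e : Quiver.Total V) :
    hom W U (ghost R e) = W.word e.right * U.star e * W.star e.left := freeHom_gen W U _

end Embedding

end CohnPathAlgebra

/-! ### Paths as injections of ℕ -/

namespace LeavittAlgebra.Code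

variable {R : Type t} [Ring R] {ι κ : Type*}

/-- The product of the isometries in a list. -/
noncomputable def listWord (U : Code R ι) (l : List ι) : LeavittAlgebra R := (l.map U.word).prod

/-- The adjoint of the product of the isometries in a list. -/
noncomputable def listStar (U : Code R ι) (l : List ι) : LeavittAlgebra R :=
  (l.map U.star).reverse.prod

/-- The composition of the maps on `ℕ` of the isometries in a list. -/
def listShift (U : Code R ι) (l : List ι) : ℕ → ℕ := l.foldr (fun i g => U.shift i ∘ g) id

theorem implements_list (U : Code R ι) (l : List ι) :
    Implements (U.listWord l) (U.listStar l) (U.listShift l) := by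
  induction l with
  | nil => exact .one
  | cons i l ih => simpa [listWord, listStar, listShift] using (U.implements i).mul ih

theorem shift_eq_shift (U : Code R ι) {i j : ι} {m n : ℕ} (h : U.shift i m = U.shift j n) :
    i = j ∧ m = n := by
  simpa using @U.shift_injective (i, m) (j, n) h

theorem listShift_injective (U : Code R ι) (l : List ι) : Function.Injective (U.listShift l) := by
  induction l with
  | nil => exact Function.injective_id
  | cons i l ih => exact fun m n h => ih (U.shift_eq_shift h).2

/-- If no map of the family takes the value `0`, then a list is determined by its value at `0`
among the lists that are not longer. -/
theorem listShift_zero_eq (U : Code R ι) (hU : ∀ i n, U.shift i n ≠ 0) {l l' : List ι} {n : ℕ}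
    (h : U.listShift l n = U.listShift l' 0) (hl : l'.length ≤ l.length) : l = l' ∧ n = 0 := by
  induction l generalizing l' with
  | nil =>
    obtain rfl := List.length_eq_zero_iff.1 (Nat.le_zero.1 hl)
    exact ⟨rfl, h⟩
  | cons i l ih =>
    cases l' with
    -- The empty list has value 0 at 0, which no nonempty list attains. A letter fixing 0 could be
    -- appended to a list without changing its value at 0.
    | nil => exact absurd h (hU _ _)
    | cons j l' =>
      obtain ⟨rfl, h'⟩ := U.shift_eq_shift h
      obtain ⟨rfl, rfl⟩ := ih h' (by simpa using hl)
      exact ⟨rfl, rfl⟩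

/-- The map on `ℕ` of a path, given by its start and its list of edges. -/
def pathShift (W : Code R κ) (U : Code R ι) (p : κ × List ι) : ℕ → ℕ :=
  W.shift p.1 ∘ U.listShift p.2

theorem pathShift_injective (W : Code R κ) (U : Code R ι) (p : κ × List ι) :
    Function.Injective (pathShift W U p) :=
  fun _ _ h => U.listShift_injective _ (W.shift_eq_shift h).2

theorem pathShift_zero_eq (W : Code R κ) (U : Code R ι) (hU : ∀ i n, U.shift i n ≠ 0)
    {p q : κ × List ι} {n : ℕ} (h : pathShift W U p n = pathShift W U q 0)
    (hl : q.2.length ≤ p.2.length) : p = q ∧ n = 0 := by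
  obtain ⟨h₁, h⟩ := W.shift_eq_shift h
  obtain ⟨h₂, hn⟩ := U.listShift_zero_eq hU h hl
  exact ⟨Prod.ext h₁ h₂, hn⟩

/-- With both arguments 0 the situation is symmetric, so the length condition can be arranged by a
swap. -/
theorem pathShift_zero_injective (W : Code R κ) (U : Code R ι) (hU : ∀ i n, U.shift i n ≠ 0)
    {p q : κ × List ι} (h : pathShift W U p 0 = pathShift W U q 0) : p = q := by
  rcases le_total q.2.length p.2.length with hl | hl
  · exact (pathShift_zero_eq W U hU h hl).1
  · exact (pathShift_zero_eq W U hU h.symm hl).1.symm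

end LeavittAlgebra.Code

/-! ### Injectivity of the homomorphism -/

namespace CohnPathAlgebra

open LeavittAlgebra

variable {R : Type t} [Ring R] {V : Type u} [Quiver.{w} V]
variable (W : Code R V) (U : Code R (Quiver.Total V))

/-- Consecutive factors meet at a common vertex v, where W_v* W_v = 1, so the product telescopes and
only the outer factors from `W` remain. -/
theorem IsPathPair.hom_normalForm {a b : V} {α β : List (Quiver.Total V)}
    (h : IsPathPair a α b β) :
    hom W U (normalForm R α b β) =
      W.word a * U.listWord α * (U.listStar β * W.star b) := by
  induction h with
  | nil v => simpa [normalForm, Code.listWord, Code.listStar] using hom_vertex W U v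
  | ghost e h ih =>
    rw [normalForm_append_singleton, map_mul, ih, hom_ghost]
    simp [Code.listWord, Code.listStar, mul_assoc, star_mul_word_cancel]
  | edge e h ih =>
    rw [normalForm_cons, map_mul, ih, hom_edge]
    simp [Code.listWord, mul_assoc, star_mul_word_cancel]

theorem end_sum_apply {ι M : Type*} [AddCommMonoid M] (s : Finset ι) (f : ι → AddMonoid.End M)
    (x : M) : (∑ i ∈ s, f i) x = ∑ i ∈ s, f i x :=
  AddMonoidHom.finsetSum_apply f s x

theorem hom_injective (hU : ∀ e n, U.shift e n ≠ 0) : Function.Injective (hom W U) := by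
  classical
  refine (injective_iff_map_eq_zero _).2 fun x hx => ?_
  obtain ⟨c, rfl⟩ := exists_eq_sum_normalForm x
  by_contra hc
  have hne : c.support.Nonempty := by
    rw [Finset.nonempty_iff_ne_empty, Ne, Finsupp.support_eq_empty]
    rintro rfl
    exact hc Finsupp.sum_zero_index
  -- Minimality is imposed on the second path only; the first needs no length condition once k = 0
  -- is known.
  obtain ⟨p, hp, hmin⟩ := c.support.exists_min_image (fun p => p.1.2.2.length) hne
  have himp (q : V × List (Quiver.Total V)) := (W.implements q.1).mul (U.implements_list q.2)
  have key : rep R (hom W U (c.sum fun p r => r • normalForm R p.1.1.2 p.1.2.1 p.1.2.2))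
      (Pi.single (Code.pathShift W U p.1.2 0) 1) (Code.pathShift W U p.1.1 0) = c p := by
    rw [Finsupp.sum, map_sum, map_sum, end_sum_apply, Finset.sum_apply,
      Finset.sum_eq_single p]
    · rw [hom_smul, p.2.hom_normalForm,
        (himp p.1.1).rep_mul_single (himp p.1.2) _ _ _ (Code.pathShift_injective W U _)]
      exact if_pos ⟨0, rfl, rfl⟩
    · intro q hq hqp
      rw [hom_smul, q.2.hom_normalForm,
        (himp q.1.1).rep_mul_single (himp q.1.2) _ _ _ (Code.pathShift_injective W U _)]
      refine if_neg ?_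
      rintro ⟨k, h₁, h₂⟩
      -- The second paths are compared first: minimality forces them to agree and k to be 0, after
      -- which `h₁` compares values of the first paths at 0.
      obtain ⟨h₃, rfl⟩ := Code.pathShift_zero_eq W U hU h₂ (hmin q hq)
      exact hqp (Subtype.ext (Prod.ext (Code.pathShift_zero_injective W U hU h₁) h₃))
    · intro h
      exact absurd hp h
  rw [hx, map_zero] at key
  exact Finsupp.mem_support_iff.1 hp key.symm

end CohnPathAlgebra

/-! ### Choice of the two codes -/

namespace LeavittAlgebra

/-- A finite set indexes a family of isometries, whose range projections have sum `1` if the set is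
not empty. -/
theorem exists_code_sum_eq_one (R : Type t) [Ring R] (ι : Type*) [Fintype ι] :
    ∃ C : Code R ι, Nonempty ι → ∑ i, C.word i * C.star i = 1 := by
  obtain ⟨n, hn⟩ : ∃ n, Fintype.card ι = n := ⟨_, rfl⟩
  cases n with
  | zero =>
    have := Fintype.card_eq_zero_iff.1 hn
    obtain ⟨C, -⟩ := exists_code R 0
    exact ⟨C.comap (Function.Embedding.ofIsEmpty), fun h => (not_isEmpty_of_nonempty ι this).elim⟩
  | succ n =>
    obtain ⟨C, hC, -⟩ := exists_code R n
    let e := Fintype.equivFinOfCardEq hn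
    refine ⟨C.comap e.toEmbedding, fun _ => ?_⟩
    rw [← hC]
    exact e.sum_comp fun i => C.word i * C.star i

/-- A finite set indexes a family of isometries by words that all contain the letter `x₂`. -/
theorem exists_code_shift_ne_zero (R : Type t) [Ring R] (ι : Type*) [Finite ι] :
    ∃ C : Code R ι, ∀ i n, C.shift i n ≠ 0 := by
  obtain ⟨n, ⟨e⟩⟩ := Finite.exists_equiv_fin ι
  -- One word more than needed is taken and the last, x₁ⁿ, is dropped. Its map already takes 0 to 0,
  -- so by joint injectivity no other map takes the value 0.
  obtain ⟨C, -, hC⟩ := exists_code R n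
  refine ⟨C.comap (e.toEmbedding.trans Fin.castSuccEmb), fun i m h => ?_⟩
  exact (Fin.castSucc_lt_last (e i)).ne (C.shift_eq_shift (h.trans hC.symm)).1

end LeavittAlgebra

theorem corollary2p6 (k : Type s) [Field k] (R : Type t) [Ring R] [Algebra k R]
    (V : Type u) [Quiver.{w} V] [Fintype V] [Finite (Quiver.Total V)] :
    ∃ φ : CohnPathAlgebra R V →ₙ+* LeavittAlgebra R,
      Function.Injective φ ∧
      (∀ (c : R) (a : CohnPathAlgebra R V), φ (c • a) = LeavittAlgebra.coeff R c * φ a) ∧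
      (∀ (c : R) (a : CohnPathAlgebra R V),
        φ (MulOpposite.op c • a) = φ a * LeavittAlgebra.coeff R c) ∧
      (Nonempty V → φ (∑ v : V, CohnPathAlgebra.vertex R v) = 1) := by
  obtain ⟨W, hW⟩ := LeavittAlgebra.exists_code_sum_eq_one R V
  obtain ⟨U, hU⟩ := LeavittAlgebra.exists_code_shift_ne_zero R (Quiver.Total V)
  refine ⟨CohnPathAlgebra.hom W U, CohnPathAlgebra.hom_injective W U hU,
    CohnPathAlgebra.hom_smul W U, CohnPathAlgebra.hom_op_smul W U, fun h => ?_⟩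
  simpa only [map_sum, CohnPathAlgebra.hom_vertex] using hW h
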